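/- Let $(\breve N,\breve g)$ be a semi-Riemannian manifold with Levi-Civita connection $\breve\nabla$, let $p,q$ be positive integers, and let $\breve J$ be a smooth $(1,1)$-tensor field on $\breve N$ with $\breve J^2=p\breve J+qI$, $\breve g(\breve JX,Y)=\breve g(X,\breve JY)$ and $\breve\nabla\breve J=0$ (that is, $(\breve N,\breve g,\breve J)$ is a locally metallic semi-Riemannian manifold). Let $N$ be an immersed lightlike submanifold of $\breve N$: the radical $\mathrm{Rad}(TN)=TN\cap TN^\perp$ has constant rank $r\ge 1$. Let $S(TN)$ be a screen distribution (a smooth complement of $\mathrm{Rad}(TN)$ in $TN$), let $S(TN^\perp)$ be a screen transversal bundle (a smooth complement of $\mathrm{Rad}(TN)$ in $TN^\perp$), and let $\mathrm{ltr}(TN)$ be a lightlike transversal bundle (a smooth null subbundle of $T\breve N|_N$, orthogonal to $S(TN)$ and to $S(TN^\perp)$), so that $$T\breve N|_N=TN\oplus \mathrm{ltr}(TN)\oplus S(TN^\perp).$$ For $W\in\Gamma(TN)$ and $V\in\Gamma(TN)$, let $\nabla_WV$ and $h^s(W,V)$ be the components of $\breve\nabla_WV$ in $TN$ and in $S(TN^\perp)$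 for this decomposition. Suppose that $N$ is a radical screen transversal lightlike submanifold, i.e. $$\breve J\,\mathrm{Rad}(TN)\subset S(TN^\perp),\qquad \breve J\,S(TN)=S(TN),$$ and that $\breve J\,\mathrm{ltr}(TN)\subset S(TN^\perp)$. Then $S(TN)$ defines a totally geodesic foliation of $N$ (it is involutive, and $\nabla_WU\in\Gamma(S(TN))$ for all $W,U\in\Gamma(S(TN))$) if and only if, for all $W,U\in\Gamma(S(TN))$, the vector field $h^s(W,\breve JU)-p\,h^s(W,U)$ has no component along $\breve J\,\mathrm{ltr}(TN)$ in the sense of the metric, i.e. $$\breve g\bigl(h^s(W,\breve JU)-p\,h^s(W,U),\,\breve J\xi'\bigr)=0\quad\text{for all }\xi'\in \mathrm{ltr}(TN).$$ -/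

import Mathlib

open Bundle Manifold
open scoped Manifold ContDiff Topology

noncomputable section

section Ambient

variable {E : Type*} [NormedAddCommGroup E] [NormedSpace ℝ E]
  {M : Type*} [TopologicalSpace M] [ChartedSpace E M] [IsManifold 𝓘(ℝ, E) ∞ M]

/-- A semi-Riemannian metric: a smooth symmetric nondegenerate `(0,2)`-tensor field
(nondegeneracy makes its index constant on connected components). -/
structure SemiRiemannianMetric (E : Type*) [NormedAddCommGroup E] [NormedSpace ℝ E]
    (M : Type*) [TopologicalSpace M] [ChartedSpace E M] [IsManifold 𝓘(ℝ, E) ∞ M] where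
  /-- The scalar product on each tangent space. -/
  inner (x : M) : TangentSpace 𝓘(ℝ, E) x →L[ℝ] TangentSpace 𝓘(ℝ, E) x →L[ℝ] ℝ
  symm (x : M) (v w : TangentSpace 𝓘(ℝ, E) x) : inner x v w = inner x w v
  nondegenerate (x : M) (v : TangentSpace 𝓘(ℝ, E) x) (hv : ∀ w, inner x v w = 0) : v = 0
  contMDiff : ContMDiff 𝓘(ℝ, E) (𝓘(ℝ, E).prod 𝓘(ℝ, E →L[ℝ] E →L[ℝ] ℝ)) ∞
    (fun x ↦ TotalSpace.mk' (E →L[ℝ] E →L[ℝ] ℝ) x (inner x))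

/-- The orthogonal complement, with respect to `g`, of a subspace of a tangent space. -/
def SemiRiemannianMetric.orth (g : SemiRiemannianMetric E M) {x : M}
    (D : Submodule ℝ (TangentSpace 𝓘(ℝ, E) x)) : Submodule ℝ (TangentSpace 𝓘(ℝ, E) x) where
  carrier := {v | ∀ w ∈ D, g.inner x v w = 0}
  add_mem' := by
    intro a b ha hb w hw
    simp [ha w hw, hb w hw]
  zero_mem' := by
    intro w _
    simp
  smul_mem' := by
    intro c a ha w hw
    simp [ha w hw]

/-- `X` has no component in the direction of the subspace `D`, measured by the metric:
`g(X, v) = 0` for all `v ∈ D`. -/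
def SemiRiemannianMetric.HasNoComponentIn (g : SemiRiemannianMetric E M) {x : M}
    (X : TangentSpace 𝓘(ℝ, E) x) (D : Submodule ℝ (TangentSpace 𝓘(ℝ, E) x)) : Prop :=
  ∀ v ∈ D, g.inner x X v = 0

/-- `cov` is the Levi-Civita connection of `g`: it is torsion-free and metric.
Recall that `cov Y x (X x)` is `(∇_X Y)(x)`. -/
structure IsLeviCivita (g : SemiRiemannianMetric E M)
    (cov : CovariantDerivative 𝓘(ℝ, E) E (TangentSpace 𝓘(ℝ, E) : M → Type _)) : Prop where
  torsion_free (X Y : Π x : M, TangentSpace 𝓘(ℝ, E) x) (x : M)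
    (hX : MDifferentiableAt 𝓘(ℝ, E) 𝓘(ℝ, E).tangent
      (fun y ↦ (⟨y, X y⟩ : TangentBundle 𝓘(ℝ, E) M)) x)
    (hY : MDifferentiableAt 𝓘(ℝ, E) 𝓘(ℝ, E).tangent
      (fun y ↦ (⟨y, Y y⟩ : TangentBundle 𝓘(ℝ, E) M)) x) :
    cov Y x (X x) - cov X x (Y x) = VectorField.mlieBracket 𝓘(ℝ, E) X Y x
  metric (X Y : Π x : M, TangentSpace 𝓘(ℝ, E) x) (x : M) (w : TangentSpace 𝓘(ℝ, E) x)
    (hX : MDifferentiableAt 𝓘(ℝ, E) 𝓘(ℝ, E).tangent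
      (fun y ↦ (⟨y, X y⟩ : TangentBundle 𝓘(ℝ, E) M)) x)
    (hY : MDifferentiableAt 𝓘(ℝ, E) 𝓘(ℝ, E).tangent
      (fun y ↦ (⟨y, Y y⟩ : TangentBundle 𝓘(ℝ, E) M)) x) :
    mvfderiv 𝓘(ℝ, E) (fun y ↦ g.inner y (X y) (Y y)) x w =
      g.inner x (cov X x w) (Y x) + g.inner x (X x) (cov Y x w)

/-- `J` is a smooth `(1,1)`-tensor field with `J² = p J + q I`, for positive integers `p`, `q`,
and the metric `g` is `J`-compatible: `(M, g, J)` is a metallic semi-Riemannian manifold. -/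
structure IsMetallic (g : SemiRiemannianMetric E M)
    (J : Π x : M, TangentSpace 𝓘(ℝ, E) x →L[ℝ] TangentSpace 𝓘(ℝ, E) x) (p q : ℕ) : Prop where
  p_pos : 0 < p
  q_pos : 0 < q
  contMDiff : ContMDiff 𝓘(ℝ, E) (𝓘(ℝ, E).prod 𝓘(ℝ, E →L[ℝ] E)) ∞
    (fun x ↦ TotalSpace.mk' (E →L[ℝ] E) (E := fun x : M ↦
      TangentSpace 𝓘(ℝ, E) x →L[ℝ] TangentSpace 𝓘(ℝ, E) x) x (J x))
  sq (x : M) (v : TangentSpace 𝓘(ℝ, E) x) : J x (J x v) = (p : ℝ) • J x v + (q : ℝ) • v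
  compatible (x : M) (v w : TangentSpace 𝓘(ℝ, E) x) :
    g.inner x (J x v) w = g.inner x v (J x w)

/-- The `(1,1)`-tensor field `J` is parallel for the connection `cov`: `∇_W (J U) = J (∇_W U)`. -/
def IsParallel (cov : CovariantDerivative 𝓘(ℝ, E) E (TangentSpace 𝓘(ℝ, E) : M → Type _))
    (J : Π x : M, TangentSpace 𝓘(ℝ, E) x →L[ℝ] TangentSpace 𝓘(ℝ, E) x) : Prop :=
  ∀ (U : Π x : M, TangentSpace 𝓘(ℝ, E) x) (x : M) (w : TangentSpace 𝓘(ℝ, E) x),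
    MDifferentiableAt 𝓘(ℝ, E) 𝓘(ℝ, E).tangent
      (fun y ↦ (⟨y, U y⟩ : TangentBundle 𝓘(ℝ, E) M)) x →
    cov (fun y ↦ J y (U y)) x w = J x (cov U x w)

end Ambient

section Submanifold

variable {E : Type*} [NormedAddCommGroup E] [NormedSpace ℝ E]
  {M : Type*} [TopologicalSpace M] [ChartedSpace E M] [IsManifold 𝓘(ℝ, E) ∞ M]
  {E' : Type*} [NormedAddCommGroup E'] [NormedSpace ℝ E']
  {N : Type*} [TopologicalSpace N] [ChartedSpace E' N]

/-- A smooth vector subbundle of `f^* TM` (that is, of `TM|_N` when `f` is an immersion of `N`):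
near every point it is spanned by a smooth frame. -/
def IsSmoothSubbundle (E' : Type*) [NormedAddCommGroup E'] [NormedSpace ℝ E']
    {N : Type*} [TopologicalSpace N] [ChartedSpace E' N] (f : N → M)
    (D : Π x : N, Submodule ℝ (TangentSpace 𝓘(ℝ, E) (f x))) : Prop :=
  ∀ x₀ : N, ∃ (k : ℕ) (e : Fin k → Π x : N, TangentSpace 𝓘(ℝ, E) (f x)) (u : Set N),
    IsOpen u ∧ x₀ ∈ u ∧
    (∀ i, ContMDiffOn 𝓘(ℝ, E') 𝓘(ℝ, E).tangent ∞
      (fun x ↦ (⟨f x, e i x⟩ : TangentBundle 𝓘(ℝ, E) M)) u) ∧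
    ∀ x ∈ u, LinearIndependent ℝ (fun i ↦ e i x) ∧
      Submodule.span ℝ (Set.range fun i ↦ e i x) = D x

/-- The tangent space of the immersed submanifold at `x`, as a subspace of `T_{f x} M`. -/
def tangentAlong (E' : Type*) [NormedAddCommGroup E'] [NormedSpace ℝ E']
    {N : Type*} [TopologicalSpace N] [ChartedSpace E' N] (f : N → M) (x : N) :
    Submodule ℝ (TangentSpace 𝓘(ℝ, E) (f x)) :=
  (mfderiv 𝓘(ℝ, E') 𝓘(ℝ, E) f x).toLinearMap.range

/-- The normal space `(T_x N)^⊥` of the immersed submanifold. -/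
def normalAlong (E' : Type*) [NormedAddCommGroup E'] [NormedSpace ℝ E']
    {N : Type*} [TopologicalSpace N] [ChartedSpace E' N] (g : SemiRiemannianMetric E M)
    (f : N → M) (x : N) : Submodule ℝ (TangentSpace 𝓘(ℝ, E) (f x)) :=
  g.orth (tangentAlong E' f x)

/-- The radical `Rad(T_x N) = T_x N ∩ (T_x N)^⊥`. -/
def radicalAlong (E' : Type*) [NormedAddCommGroup E'] [NormedSpace ℝ E']
    {N : Type*} [TopologicalSpace N] [ChartedSpace E' N] (g : SemiRiemannianMetric E M)
    (f : N → M) (x : N) : Submodule ℝ (TangentSpace 𝓘(ℝ, E) (f x)) :=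
  tangentAlong E' f x ⊓ normalAlong E' g f x

/-- A lightlike submanifold `(N, g, S(TN), S(TN^⊥))` of `(M, g)`, given by the immersion `f`,
together with a lightlike transversal bundle `ltr(TN)`. All bundles are regarded as subbundles
of `TM|_N = f^* TM`, and `T_x N` is identified with its image under the differential of `f`. -/
structure LightlikeSubmanifold (E' : Type*) [NormedAddCommGroup E'] [NormedSpace ℝ E']
    {N : Type*} [TopologicalSpace N] [ChartedSpace E' N]
    (g : SemiRiemannianMetric E M) (f : N → M) where
  isImmersion : IsImmersion 𝓘(ℝ, E') 𝓘(ℝ, E) ∞ f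
  /-- The rank `r ≥ 1` of the radical distribution. -/
  r : ℕ
  one_le_r : 1 ≤ r
  finrank_radical (x : N) : Module.finrank ℝ (radicalAlong E' g f x) = r
  /-- The screen distribution `S(TN)`. It is automatically nondegenerate and orthogonal
  to `Rad(TN)`, being a complement of the radical of `TN`. -/
  screen (x : N) : Submodule ℝ (TangentSpace 𝓘(ℝ, E) (f x))
  screen_smooth : IsSmoothSubbundle E' f screen
  radical_sup_screen (x : N) : radicalAlong E' g f x ⊔ screen x = tangentAlong E' f x
  radical_disjoint_screen (x : N) : Disjoint (radicalAlong E' g f x) (screen x)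
  /-- The screen transversal bundle `S(TN^⊥)`, a complement of `Rad(TN)` in `TN^⊥`. -/
  screenTrans (x : N) : Submodule ℝ (TangentSpace 𝓘(ℝ, E) (f x))
  screenTrans_smooth : IsSmoothSubbundle E' f screenTrans
  radical_sup_screenTrans (x : N) :
    radicalAlong E' g f x ⊔ screenTrans x = normalAlong E' g f x
  radical_disjoint_screenTrans (x : N) : Disjoint (radicalAlong E' g f x) (screenTrans x)
  /-- The lightlike transversal bundle `ltr(TN)`: it is null, orthogonal to `S(TN)` and to
  `S(TN^⊥)`, and `TM|_N = TN ⊕ ltr(TN) ⊕ S(TN^⊥)`. -/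
  ltr (x : N) : Submodule ℝ (TangentSpace 𝓘(ℝ, E) (f x))
  ltr_smooth : IsSmoothSubbundle E' f ltr
  ltr_null (x : N) : ∀ v ∈ ltr x, ∀ w ∈ ltr x, g.inner (f x) v w = 0
  ltr_orth_screen (x : N) : ∀ v ∈ ltr x, ∀ w ∈ screen x, g.inner (f x) v w = 0
  ltr_orth_screenTrans (x : N) : ∀ v ∈ ltr x, ∀ w ∈ screenTrans x, g.inner (f x) v w = 0
  tangent_disjoint_ltr (x : N) : Disjoint (tangentAlong E' f x) (ltr x)
  isCompl_screenTrans (x : N) : IsCompl (screenTrans x) (tangentAlong E' f x ⊔ ltr x)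

/-- The covariant derivative `∇_w V` along `f`, at `x` and in the direction `w ∈ T_x N`, of a
section `V` of `f^* TM` (the pull-back connection). Let `e_i` be the local frame of `TM` which is
constant in the trivialization at `f x`, and `V = ∑ v^i e_i ∘ f` near `x`. Then
`∇_w V = ∑ dv^i(w) e_i + ∑ v^i(x) ∇_{df(w)} e_i`, and `∑ v^i(x) e_i` is the frame-constant
extension `FiberBundle.extend E (V x)` of the vector `V x`. -/
def covAlong (cov : CovariantDerivative 𝓘(ℝ, E) E (TangentSpace 𝓘(ℝ, E) : M → Type _))
    (f : N → M) (V : Π x : N, TangentSpace 𝓘(ℝ, E) (f x)) (x : N)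
    (w : TangentSpace 𝓘(ℝ, E') x) : TangentSpace 𝓘(ℝ, E) (f x) :=
  letI e := trivializationAt E (TangentSpace 𝓘(ℝ, E) : M → Type _) (f x)
  e.symmL ℝ (f x)
      (mvfderiv 𝓘(ℝ, E') (fun y : N ↦ (e (⟨f y, V y⟩ : TangentBundle 𝓘(ℝ, E) M)).2) x w)
    + cov (FiberBundle.extend E (V x)) (f x) (mfderiv 𝓘(ℝ, E') 𝓘(ℝ, E) f x w)

/-- The section `f_* W` of `f^* TM` given by a vector field `W` on `N`. -/
def pushforward (f : N → M) (W : Π x : N, TangentSpace 𝓘(ℝ, E') x) (x : N) :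
    TangentSpace 𝓘(ℝ, E) (f x) :=
  mfderiv 𝓘(ℝ, E') 𝓘(ℝ, E) f x (W x)

/-- `W ∈ Γ(D)`: `W` is a smooth vector field on `N` with values in the subbundle `D` of `TN`. -/
def IsSectionOf [IsManifold 𝓘(ℝ, E') ∞ N] (f : N → M) (D : Π x : N, Submodule ℝ (TangentSpace 𝓘(ℝ, E) (f x)))
    (W : Π x : N, TangentSpace 𝓘(ℝ, E') x) : Prop :=
  ContMDiff 𝓘(ℝ, E') 𝓘(ℝ, E').tangent ∞ (fun x ↦ (⟨x, W x⟩ : TangentBundle 𝓘(ℝ, E') N)) ∧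
    ∀ x, pushforward f W x ∈ D x

namespace LightlikeSubmanifold

variable {g : SemiRiemannianMetric E M} {f : N → M}

theorem isCompl_tangent (L : LightlikeSubmanifold E' g f) (x : N) :
    IsCompl (tangentAlong E' f x) (L.ltr x ⊔ L.screenTrans x) := by
  have h := L.isCompl_screenTrans x
  refine ⟨?_, ?_⟩
  · exact (L.tangent_disjoint_ltr x).disjoint_sup_right_of_disjoint_sup_left h.disjoint.symm
  · rw [codisjoint_iff, ← sup_assoc, sup_comm]
    exact h.sup_eq_top

/-- The induced connection: `∇_W V` is the component in `TN` of the ambient `∇_W V`, for the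
decomposition `TM|_N = TN ⊕ tr(TN)`, `tr(TN) = ltr(TN) ⊕ S(TN^⊥)`. Here `V` is a section of `TN`
regarded as a section of `f^* TM`. -/
def inducedConn (L : LightlikeSubmanifold E' g f)
    (cov : CovariantDerivative 𝓘(ℝ, E) E (TangentSpace 𝓘(ℝ, E) : M → Type _))
    (W : Π x : N, TangentSpace 𝓘(ℝ, E') x) (V : Π x : N, TangentSpace 𝓘(ℝ, E) (f x)) (x : N) :
    TangentSpace 𝓘(ℝ, E) (f x) :=
  Submodule.projection _ _ (L.isCompl_tangent x) (covAlong cov f V x (W x))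

/-- The screen second fundamental form: `h^s(W, V)` is the component in `S(TN^⊥)` of the ambient
`∇_W V`, for the decomposition `TM|_N = TN ⊕ ltr(TN) ⊕ S(TN^⊥)`. Here `V` is a section of `TN`
regarded as a section of `f^* TM`. -/
def hs (L : LightlikeSubmanifold E' g f)
    (cov : CovariantDerivative 𝓘(ℝ, E) E (TangentSpace 𝓘(ℝ, E) : M → Type _))
    (W : Π x : N, TangentSpace 𝓘(ℝ, E') x) (V : Π x : N, TangentSpace 𝓘(ℝ, E) (f x)) (x : N) :
    TangentSpace 𝓘(ℝ, E) (f x) :=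
  Submodule.projection _ _ (L.isCompl_screenTrans x) (covAlong cov f V x (W x))

/-- `J Rad(TN) ⊆ S(TN^⊥)`. -/
def IsScreenTransversal (L : LightlikeSubmanifold E' g f)
    (J : Π x : M, TangentSpace 𝓘(ℝ, E) x →L[ℝ] TangentSpace 𝓘(ℝ, E) x) : Prop :=
  ∀ x, (radicalAlong E' g f x).map (J (f x)).toLinearMap ≤ L.screenTrans x

/-- `J Rad(TN) ⊆ S(TN^⊥)` and `J S(TN) = S(TN)`. -/
def IsRadicalScreenTransversal (L : LightlikeSubmanifold E' g f)
    (J : Π x : M, TangentSpace 𝓘(ℝ, E) x →L[ℝ] TangentSpace 𝓘(ℝ, E) x) : Prop :=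
  L.IsScreenTransversal J ∧ ∀ x, (L.screen x).map (J (f x)).toLinearMap = L.screen x

/-- The subbundle `J ltr(TN)`. -/
def mapLtr (L : LightlikeSubmanifold E' g f)
    (J : Π x : M, TangentSpace 𝓘(ℝ, E) x →L[ℝ] TangentSpace 𝓘(ℝ, E) x) (x : N) :
    Submodule ℝ (TangentSpace 𝓘(ℝ, E) (f x)) :=
  (L.ltr x).map (J (f x)).toLinearMap

/-- A distribution `D ⊆ TN` defines a totally geodesic foliation of `N` (with the induced
connection): it is involutive, and `∇_W U ∈ Γ(D)` for all `W, U ∈ Γ(D)`. -/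
def DefinesTotallyGeodesicFoliation [IsManifold 𝓘(ℝ, E') ∞ N]
    (L : LightlikeSubmanifold E' g f)
    (cov : CovariantDerivative 𝓘(ℝ, E) E (TangentSpace 𝓘(ℝ, E) : M → Type _))
    (D : Π x : N, Submodule ℝ (TangentSpace 𝓘(ℝ, E) (f x))) : Prop :=
  ∀ W U : Π x : N, TangentSpace 𝓘(ℝ, E') x, IsSectionOf f D W → IsSectionOf f D U →
    ∀ x, pushforward f (VectorField.mlieBracket 𝓘(ℝ, E') W U) x ∈ D x ∧
      L.inducedConn cov W (pushforward f U) x ∈ D x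

end LightlikeSubmanifold

end Submanifold

end

/-! For W, U in S(TN) and ξ in ltr(TN), the vector Jξ lies in S(TN^⊥), which is orthogonal to TN ⊕
ltr(TN). Pairing h^s with Jξ therefore sees the whole ambient derivative D = ∇̆_W U. As J is
parallel and self-adjoint and J² = pJ + q, g(h^s(W, JU) - p h^s(W, U), Jξ) = g(JD - pD, Jξ) = g(D,
J²ξ - pJξ) = q g(D, ξ) = q g(∇_W U, ξ), the last step because ltr(TN) is orthogonal to ltr(TN) ⊕
S(TN^⊥). Inside TN, being orthogonal to ltr(TN) means lying in S(TN) (`mem_screen_iff`), and q ≠ 0,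
so the metric condition is equivalent to ∇_W U ∈ S(TN). Involutivity then follows since ∇ is
torsion-free (`pushforward_mlieBracket_eq`).

The analytic work is to carry two properties of ∇̆ over to the pull-back connection along the
immersion: J stays parallel (`IsParallel.covAlong_apply`) and the torsion vanishes
(`IsLeviCivita.covAlong_pushforward_sub`). -/

noncomputable section

/-! ### Lie brackets as commutators of derivations on vector-valued functions -/

section
variable {E : Type*} [NormedAddCommGroup E] [NormedSpace ℝ E]
  {E' : Type*} [NormedAddCommGroup E'] [NormedSpace ℝ E']
  {N : Type*} [TopologicalSpace N] [ChartedSpace E' N]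

/-- The second derivatives of `G` along two vector fields commute up to the Lie bracket. -/
theorem fderiv_fderiv_apply_sub [CompleteSpace E'] {G : E' → E} {z : E'}
    (hG : ContDiffAt ℝ ∞ G z) {U W : E' → E'}
    (hU : DifferentiableAt ℝ U z) (hW : DifferentiableAt ℝ W z) :
    fderiv ℝ (fun y ↦ fderiv ℝ G y (U y)) z (W z) - fderiv ℝ (fun y ↦ fderiv ℝ G y (W y)) z (U z)
      = fderiv ℝ G z (VectorField.lieBracket ℝ W U z) := by
  have hd : DifferentiableAt ℝ (fderiv ℝ G) z :=
    (hG.fderiv_right (m := 1) (by norm_cast)).differentiableAt one_ne_zero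
  have h2 : (2 : WithTop ℕ∞) ≤ ∞ := WithTop.coe_le_coe.2 (le_top (a := (2 : ℕ∞)))
  -- The second-order terms D²G(W, U) and D²G(U, W) cancel, leaving DG(DU·W - DW·U).
  have hs := hG.isSymmSndFDerivAt (by simpa using h2) (W z) (U z)
  rw [fderiv_clm_apply hd hU, fderiv_clm_apply hd hW]
  simp [VectorField.lieBracket_eq, hs]

theorem mvfderiv_congr_of_eventuallyEq {H K : N → E} {y : N} (h : H =ᶠ[𝓝 y] K) :
    mvfderiv 𝓘(ℝ, E') H y = mvfderiv 𝓘(ℝ, E') K y := by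
  ext v
  exact congrArg (fun A : E' →L[ℝ] E ↦ A v) h.mfderiv_eq

theorem mvfderiv_comp_of_normedSpace {F : Type*} [NormedAddCommGroup F] [NormedSpace ℝ F]
    {M : Type*} [TopologicalSpace M] [ChartedSpace F M]
    {G : M → E} {f : N → M} {x : N} (hG : MDifferentiableAt 𝓘(ℝ, F) 𝓘(ℝ, E) G (f x))
    (hf : MDifferentiableAt 𝓘(ℝ, E') 𝓘(ℝ, F) f x) (v : TangentSpace 𝓘(ℝ, E') x) :
    mvfderiv 𝓘(ℝ, E') (G ∘ f) x v = mvfderiv 𝓘(ℝ, F) G (f x) (mfderiv 𝓘(ℝ, E') 𝓘(ℝ, F) f x v) :=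
  mfderiv_comp_apply x hG hf v

theorem mvfderiv_eq_fderiv {F : E' → E} {z : E'} (v : E') :
    mvfderiv 𝓘(ℝ, E') F z v = fderiv ℝ F z v := by
  have := congrArg (fun A : E' →L[ℝ] E ↦ A v) (mfderiv_eq_fderiv (𝕜 := ℝ) (f := F) (x := z))
  exact this

variable [IsManifold 𝓘(ℝ, E') ∞ N]

/-- A vector-valued function `G` on a manifold satisfies `W (U G) - U (W G) = [W, U] G`. -/
theorem mvfderiv_mvfderiv_apply_sub [CompleteSpace E'] {G : N → E} {x : N}
    (hG : ContMDiffAt 𝓘(ℝ, E') 𝓘(ℝ, E) ∞ G x) {U W : Π y : N, TangentSpace 𝓘(ℝ, E') y}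
    (hU : MDifferentiableAt 𝓘(ℝ, E') 𝓘(ℝ, E').tangent
      (fun y ↦ (⟨y, U y⟩ : TangentBundle 𝓘(ℝ, E') N)) x)
    (hW : MDifferentiableAt 𝓘(ℝ, E') 𝓘(ℝ, E').tangent
      (fun y ↦ (⟨y, W y⟩ : TangentBundle 𝓘(ℝ, E') N)) x) :
    mvfderiv 𝓘(ℝ, E') (fun y ↦ mvfderiv 𝓘(ℝ, E') G y (U y)) x (W x)
      - mvfderiv 𝓘(ℝ, E') (fun y ↦ mvfderiv 𝓘(ℝ, E') G y (W y)) x (U x)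
      = mvfderiv 𝓘(ℝ, E') G x (VectorField.mlieBracket 𝓘(ℝ, E') W U x) := by
  have : IsManifold 𝓘(ℝ, E') 1 N := .of_le (n := ∞) (by simp)
  let ψ := extChartAt 𝓘(ℝ, E') x
  -- Everything is read in the chart ψ: G becomes G' and a field V becomes P V, which `hchart`
  -- identifies with dψ(V).
  let G' : E' → E := G ∘ ψ.symm
  let P (V : Π y : N, TangentSpace 𝓘(ℝ, E') y) : E' → E' :=
    VectorField.mpullbackWithin 𝓘(ℝ, E') 𝓘(ℝ, E') ψ.symm V (Set.range 𝓘(ℝ, E'))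
  have hx : x ∈ ψ.source := mem_extChartAt_source x
  have hψ : ∀ y ∈ ψ.source, MDifferentiableAt 𝓘(ℝ, E') 𝓘(ℝ, E') ψ y := fun y hy ↦
    mdifferentiableAt_extChartAt (by simpa [ψ] using hy)
  have hsource : ∀ᶠ y in 𝓝 x, y ∈ ψ.source := extChartAt_source_mem_nhds x
  have hG' : ContDiffAt ℝ ∞ G' (ψ x) := by
    have h1 : ContMDiffAt 𝓘(ℝ, E') 𝓘(ℝ, E') ∞ ψ.symm (ψ x) := by
      have := contMDiffWithinAt_extChartAt_symm_range (I := 𝓘(ℝ, E')) (n := ∞) x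
        (mem_extChartAt_target x)
      rwa [modelWithCornersSelf_coe, Set.range_id, contMDiffWithinAt_univ] at this
    exact (hG.comp_of_eq h1 (extChartAt_to_inv x)).contDiffAt
  have hset : (extChartAt 𝓘(ℝ, E') x).symm ⁻¹' Set.univ ∩ Set.range 𝓘(ℝ, E') = Set.univ := by
    rw [Set.preimage_univ, Set.univ_inter, modelWithCornersSelf_coe, Set.range_id]
  have hP {V : Π y : N, TangentSpace 𝓘(ℝ, E') y}
      (hV : MDifferentiableAt 𝓘(ℝ, E') 𝓘(ℝ, E').tangent
        (fun y ↦ (⟨y, V y⟩ : TangentBundle 𝓘(ℝ, E') N)) x) : DifferentiableAt ℝ (P V) (ψ x) := by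
    have :=
      hV.mdifferentiableWithinAt (s := Set.univ)
        |>.differentiableWithinAt_mpullbackWithin_vectorField
    rw [hset] at this
    exact differentiableWithinAt_univ.1 this
  have hchart (y : N) (hy : y ∈ ψ.source) (V : Π y : N, TangentSpace 𝓘(ℝ, E') y) :
      P V (ψ y) = mvfderiv 𝓘(ℝ, E') ψ y (V y) := by
    have key := ContinuousLinearMap.inverse_eq
      (mfderivWithin_extChartAt_symm_comp_mfderiv_extChartAt' hy)
      (mfderiv_extChartAt_comp_mfderivWithin_extChartAt_symm' hy)
    -- V is evaluated at ψ⁻¹(ψ y), which equals y only propositionally; both tangent spaces are E'.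
    have aux : ∀ y', y' = y → (mfderiv 𝓘(ℝ, E') 𝓘(ℝ, E') ψ y : E' →L[ℝ] E') (V y' : E')
        = mvfderiv 𝓘(ℝ, E') ψ y (V y) := by
      rintro _ rfl; rfl
    rw [← aux _ (ψ.left_inv hy)]
    exact congrArg (fun A : E' →L[ℝ] E' ↦ A (V (ψ.symm (ψ y)) : E')) key
  have hcomp (F : E' → E) (y : N) (hy : y ∈ ψ.source) (hF : DifferentiableAt ℝ F (ψ y))
      (v : TangentSpace 𝓘(ℝ, E') y) :
      mvfderiv 𝓘(ℝ, E') (F ∘ ψ) y v = fderiv ℝ F (ψ y) (mvfderiv 𝓘(ℝ, E') ψ y v) := by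
    rw [mvfderiv_comp_of_normedSpace hF.mdifferentiableAt (hψ y hy)]
    exact mvfderiv_eq_fderiv _
  have hGG' {y : N} (hy : y ∈ ψ.source) : G =ᶠ[𝓝 y] G' ∘ ψ := by
    filter_upwards [(isOpen_extChartAt_source x).mem_nhds hy] with z hz
    simp [G', ψ.left_inv hz]
  have hdG : ∀ᶠ y in 𝓝 x, ∀ v, mvfderiv 𝓘(ℝ, E') G y v
      = fderiv ℝ G' (ψ y) (mvfderiv 𝓘(ℝ, E') ψ y v) := by
    have hd : ∀ᶠ y in 𝓝 x, DifferentiableAt ℝ G' (ψ y) := by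
      refine (continuousAt_extChartAt x).eventually ?_
      filter_upwards [(hG'.of_le (m := 1) (by simp)).eventually (by simp)] with z hz
      exact hz.differentiableAt one_ne_zero
    filter_upwards [hsource, hd] with y hy hy' v
    rw [mvfderiv_congr_of_eventuallyEq (hGG' hy), hcomp _ y hy hy']
  have hfd : DifferentiableAt ℝ (fderiv ℝ G') (ψ x) :=
    (hG'.fderiv_right (m := 1) (by norm_cast)).differentiableAt one_ne_zero
  have hsecond {V : Π y : N, TangentSpace 𝓘(ℝ, E') y} (hV : DifferentiableAt ℝ (P V) (ψ x))
      (v : TangentSpace 𝓘(ℝ, E') x) :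
      mvfderiv 𝓘(ℝ, E') (fun y ↦ mvfderiv 𝓘(ℝ, E') G y (V y)) x v
        = fderiv ℝ (fun z ↦ fderiv ℝ G' z (P V z)) (ψ x) (mvfderiv 𝓘(ℝ, E') ψ x v) := by
    rw [← hcomp _ x hx (hfd.clm_apply hV)]
    congr 1
    apply mvfderiv_congr_of_eventuallyEq
    filter_upwards [hdG, hsource] with y hy hys
    rw [hy, Function.comp_apply, hchart y hys]
  rw [hsecond (hP hU), hsecond (hP hW), ← hchart x hx, ← hchart x hx,
    fderiv_fderiv_apply_sub hG' (hP hU) (hP hW), hdG.self_of_nhds]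
  congr 1
  -- The bracket on N is (dψ)⁻¹ applied to the bracket of the chart representatives, so dψ undoes
  -- the inverse.
  have key : ∀ v : E', (mfderiv 𝓘(ℝ, E') 𝓘(ℝ, E') ψ x : E' →L[ℝ] E')
      ((mfderiv 𝓘(ℝ, E') 𝓘(ℝ, E') ψ x : E' →L[ℝ] E').inverse v) = v :=
    (isInvertible_mfderiv_extChartAt hx).self_apply_inverse
  have hbr := VectorField.mlieBracketWithin_apply (I := 𝓘(ℝ, E')) (V := W) (W := U)
    (s := Set.univ) (x₀ := x)
  rw [hset, VectorField.mlieBracketWithin_univ] at hbr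
  rw [hbr, ← VectorField.lieBracketWithin_univ]
  exact (key _).symm
end

/-! ### Connections in a trivialization of the tangent bundle -/

section
variable {E : Type*} [NormedAddCommGroup E] [NormedSpace ℝ E]
  {M : Type*} [TopologicalSpace M] [ChartedSpace E M]
  {E' : Type*} [NormedAddCommGroup E'] [NormedSpace ℝ E']
  {N : Type*} [TopologicalSpace N] [ChartedSpace E' N]

/-- Product rule for the evaluation of a family of continuous linear maps. -/
theorem mvfderiv_clm_apply {F G : Type*} [NormedAddCommGroup F] [NormedSpace ℝ F]
    [NormedAddCommGroup G] [NormedSpace ℝ G] {A : N → F →L[ℝ] G} {v : N → F} {x : N}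
    (hA : MDifferentiableAt 𝓘(ℝ, E') 𝓘(ℝ, F →L[ℝ] G) A x)
    (hv : MDifferentiableAt 𝓘(ℝ, E') 𝓘(ℝ, F) v x) (w : TangentSpace 𝓘(ℝ, E') x) :
    mvfderiv 𝓘(ℝ, E') (fun y ↦ A y (v y)) x w
      = mvfderiv 𝓘(ℝ, E') (fun y ↦ A y (v x)) x w + A x (mvfderiv 𝓘(ℝ, E') v x w) := by
  let B : (F →L[ℝ] G) × F → G := fun z ↦ z.1 z.2
  have hB (z : (F →L[ℝ] G) × F) :
      HasFDerivAt B (z.1.comp (.snd ℝ _ _) +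
        (ContinuousLinearMap.fst ℝ (F →L[ℝ] G) F).flip z.2) z :=
    hasFDerivAt_fst.clm_apply hasFDerivAt_snd
  have key {v' : N → F} (hv' : MDifferentiableAt 𝓘(ℝ, E') 𝓘(ℝ, F) v' x) :
      mvfderiv 𝓘(ℝ, E') (fun y ↦ A y (v' y)) x w
        = A x (mvfderiv 𝓘(ℝ, E') v' x w) + mvfderiv 𝓘(ℝ, E') A x w (v' x) := by
    have hpair : HasMFDerivAt 𝓘(ℝ, E') 𝓘(ℝ, (F →L[ℝ] G) × F) (fun y ↦ (A y, v' y)) x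
        ((mvfderiv 𝓘(ℝ, E') A x).prod (mvfderiv 𝓘(ℝ, E') v' x)) :=
      ⟨hA.continuousAt.prodMk hv'.continuousAt, hA.hasMFDerivAt.2.prodMk hv'.hasMFDerivAt.2⟩
    have h := mvfderiv_comp_of_normedSpace (G := B) (hB _).differentiableAt.mdifferentiableAt
      hpair.mdifferentiableAt w
    rw [hpair.mfderiv] at h
    refine h.trans ((mvfderiv_eq_fderiv _).trans ?_)
    rw [(hB _).fderiv]
    rfl
  -- Using `key` also for the constant family `v x` identifies the term where only A is
  -- differentiated.
  rw [key hv, key mdifferentiableAt_const, mvfderiv_const]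
  simp [add_comm]

variable [IsManifold 𝓘(ℝ, E) ∞ M]

theorem trivializationAt_extend_snd {a : M} (v : TangentSpace 𝓘(ℝ, E) a) {y : M}
    (hy : y ∈ (trivializationAt E (TangentSpace 𝓘(ℝ, E) : M → Type _) a).baseSet) :
    (trivializationAt E (TangentSpace 𝓘(ℝ, E) : M → Type _) a
      ⟨y, FiberBundle.extend E v y⟩).2
      = (trivializationAt E (TangentSpace 𝓘(ℝ, E) : M → Type _) a ⟨a, v⟩).2 := by
  simp only [FiberBundle.extend]
  rw [Trivialization.mk_symm _ hy, Trivialization.apply_symm_apply']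
  exact hy

theorem trivializationAt_snd_eq_continuousLinearMapAt {a y : M}
    (hy : y ∈ (trivializationAt E (TangentSpace 𝓘(ℝ, E) : M → Type _) a).baseSet)
    (v : TangentSpace 𝓘(ℝ, E) y) :
    (trivializationAt E (TangentSpace 𝓘(ℝ, E) : M → Type _) a ⟨y, v⟩).2
      = (trivializationAt E (TangentSpace 𝓘(ℝ, E) : M → Type _) a).continuousLinearMapAt ℝ y v := by
  rw [Trivialization.continuousLinearMapAt_apply, Trivialization.linearMapAt_apply, if_pos hy]

/-- This turns coordinates of tangent vectors into derivatives of the chart, to which the commutator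
identity applies. -/
theorem trivializationAt_snd_eq_mvfderiv {a y : M} (hy : y ∈ (chartAt E a).source)
    (v : TangentSpace 𝓘(ℝ, E) y) :
    (trivializationAt E (TangentSpace 𝓘(ℝ, E) : M → Type _) a ⟨y, v⟩).2
      = mvfderiv 𝓘(ℝ, E) (extChartAt 𝓘(ℝ, E) a) y v := by
  rw [trivializationAt_snd_eq_continuousLinearMapAt (by simpa using hy)]
  exact congrArg (fun A : E →L[ℝ] E ↦ A v)
    (TangentBundle.continuousLinearMapAt_trivializationAt hy)

/-- A connection is the flat connection of the trivialization at `a` plus its Christoffel term. -/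
theorem cov_eq_mvfderiv_add_cov_extend [FiniteDimensional ℝ E]
    (cov : CovariantDerivative 𝓘(ℝ, E) E (TangentSpace 𝓘(ℝ, E) : M → Type _))
    {σ : Π y : M, TangentSpace 𝓘(ℝ, E) y} {a : M}
    (hσ : MDifferentiableAt 𝓘(ℝ, E) 𝓘(ℝ, E).tangent
      (fun y ↦ (⟨y, σ y⟩ : TangentBundle 𝓘(ℝ, E) M)) a) (u : TangentSpace 𝓘(ℝ, E) a) :
    cov σ a u = (trivializationAt E (TangentSpace 𝓘(ℝ, E) : M → Type _) a).symmL ℝ a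
      (mvfderiv 𝓘(ℝ, E) (fun y ↦
        (trivializationAt E (TangentSpace 𝓘(ℝ, E) : M → Type _) a ⟨y, σ y⟩).2) a u)
      + cov (FiberBundle.extend E (σ a)) a u := by
  set e := trivializationAt E (TangentSpace 𝓘(ℝ, E) : M → Type _) a with he
  have ha : a ∈ e.baseSet := FiberBundle.mem_baseSet_trivializationAt' a
  have hnhds : ∀ᶠ y in 𝓝 a, y ∈ e.baseSet := e.open_baseSet.mem_nhds ha
  let c (τ : Π y : M, TangentSpace 𝓘(ℝ, E) y) : M → E := fun y ↦ (e ⟨y, τ y⟩).2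
  have hcd {τ : Π y : M, TangentSpace 𝓘(ℝ, E) y} (hτ : MDifferentiableAt 𝓘(ℝ, E) 𝓘(ℝ, E).tangent
      (fun y ↦ (⟨y, τ y⟩ : TangentBundle 𝓘(ℝ, E) M)) a) :
      MDifferentiableAt 𝓘(ℝ, E) 𝓘(ℝ, E) (c τ) a :=
    (mdifferentiableAt_section _ _).1 hτ
  let Φ (τ : Π y : M, TangentSpace 𝓘(ℝ, E) y) : TangentSpace 𝓘(ℝ, E) a :=
    cov τ a u - e.symmL ℝ a (mvfderiv 𝓘(ℝ, E) (c τ) a u)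
  -- The difference of two connections is tensorial: the Leibniz terms cancel. Hence Φ takes the
  -- same value on σ and on the frame-constant extension of σ a, whose flat derivative vanishes.
  have hΦ : TensorialAt 𝓘(ℝ, E) E Φ a := by
    constructor
    · intro h τ hh hτ
      have h1 : mvfderiv 𝓘(ℝ, E) (c (h • τ)) a = mvfderiv 𝓘(ℝ, E) (h • c τ) a := by
        apply mvfderiv_congr_of_eventuallyEq
        filter_upwards [hnhds] with y hy
        simp only [c, he, trivializationAt_snd_eq_continuousLinearMapAt hy, Pi.smul_apply',
          map_smul]
      have h2 : e.symmL ℝ a (c τ a) = τ a := by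
        simp only [c, he, trivializationAt_snd_eq_continuousLinearMapAt ha]
        exact e.symmL_continuousLinearMapAt ha _
      simp only [Φ, h1, mvfderiv_smul hh (hcd hτ), cov.isCovariantDerivativeOnUniv.leibniz hτ hh]
      simp [h2, smul_sub]
    · intro τ τ' hτ hτ'
      have h1 : mvfderiv 𝓘(ℝ, E) (c (τ + τ')) a = mvfderiv 𝓘(ℝ, E) (c τ + c τ') a := by
        apply mvfderiv_congr_of_eventuallyEq
        filter_upwards [hnhds] with y hy
        simp only [c, he, trivializationAt_snd_eq_continuousLinearMapAt hy, Pi.add_apply, map_add]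
      simp only [Φ, h1, mvfderiv_add (hcd hτ) (hcd hτ'), cov.isCovariantDerivativeOnUniv.add hτ hτ']
      simp only [add_apply, map_add]
      abel
  have key := hΦ.pointwise (σ' := FiberBundle.extend E (σ a)) hσ
    (FiberBundle.mdifferentiableAt_extend ..) (by simp)
  have h0 : mvfderiv 𝓘(ℝ, E) (c (FiberBundle.extend E (σ a))) a = 0 := by
    rw [← mvfderiv_const (I := 𝓘(ℝ, E)) ((e ⟨a, σ a⟩).2 : E) (x := a)]
    apply mvfderiv_congr_of_eventuallyEq
    filter_upwards [hnhds] with y hy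
    exact trivializationAt_extend_snd _ hy
  simp only [Φ, h0, zero_apply, map_zero, sub_zero] at key
  rw [← key, add_sub_cancel]

end

/-! ### The pull-back connection: parallel tensors and torsion -/

section
variable {E : Type*} [NormedAddCommGroup E] [NormedSpace ℝ E]
  {M : Type*} [TopologicalSpace M] [ChartedSpace E M] [IsManifold 𝓘(ℝ, E) ∞ M]
  {E' : Type*} [NormedAddCommGroup E'] [NormedSpace ℝ E']
  {N : Type*} [TopologicalSpace N] [ChartedSpace E' N]

/-- A `(1,1)`-tensor field that is parallel for a connection on `M` is parallel for the
pull-back connection along `f`. -/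
theorem IsParallel.covAlong_apply [FiniteDimensional ℝ E]
    {cov : CovariantDerivative 𝓘(ℝ, E) E (TangentSpace 𝓘(ℝ, E) : M → Type _)}
    {J : Π x : M, TangentSpace 𝓘(ℝ, E) x →L[ℝ] TangentSpace 𝓘(ℝ, E) x} (hJ : IsParallel cov J)
    {f : N → M} {x : N}
    (hJd : MDifferentiableAt 𝓘(ℝ, E) (𝓘(ℝ, E).prod 𝓘(ℝ, E →L[ℝ] E))
      (fun x ↦ TotalSpace.mk' (E →L[ℝ] E) (E := fun x : M ↦
        TangentSpace 𝓘(ℝ, E) x →L[ℝ] TangentSpace 𝓘(ℝ, E) x) x (J x)) (f x))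
    (hf : MDifferentiableAt 𝓘(ℝ, E') 𝓘(ℝ, E) f x)
    {V : Π y : N, TangentSpace 𝓘(ℝ, E) (f y)}
    (hV : MDifferentiableAt 𝓘(ℝ, E') 𝓘(ℝ, E).tangent
      (fun y ↦ (⟨f y, V y⟩ : TangentBundle 𝓘(ℝ, E) M)) x) (w : TangentSpace 𝓘(ℝ, E') x) :
    covAlong cov f (fun y ↦ J (f y) (V y)) x w = J (f x) (covAlong cov f V x w) := by
  let a := f x
  let e := trivializationAt E (TangentSpace 𝓘(ℝ, E) : M → Type _) a
  have hae : a ∈ e.baseSet := FiberBundle.mem_baseSet_trivializationAt' a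
  have hnhds : ∀ᶠ y in 𝓝 a, y ∈ e.baseSet := e.open_baseSet.mem_nhds hae
  -- `J` read in the trivialization at `f x`
  let A : M → E →L[ℝ] E := fun y ↦ (e.continuousLinearMapAt ℝ y).comp
    ((J y).comp (e.symmL ℝ y))
  have hA : MDifferentiableAt 𝓘(ℝ, E) 𝓘(ℝ, E →L[ℝ] E) A a :=
    ((mdifferentiableAt_hom_bundle _).1 hJd).2
  have hcoord {y : M} (hy : y ∈ e.baseSet) (v : TangentSpace 𝓘(ℝ, E) y) :
      (e ⟨y, J y v⟩).2 = A y (e ⟨y, v⟩).2 := by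
    simp only [A, e, trivializationAt_snd_eq_continuousLinearMapAt hy,
      ContinuousLinearMap.comp_apply]
    rw [e.symmL_continuousLinearMapAt hy]
  have hsymm (v : E) : e.symmL ℝ a (A a v) = J a (e.symmL ℝ a v) := by
    simp only [A, ContinuousLinearMap.comp_apply]
    exact e.symmL_continuousLinearMapAt hae _
  let v : N → E := fun y ↦ (e ⟨f y, V y⟩).2
  have hv : MDifferentiableAt 𝓘(ℝ, E') 𝓘(ℝ, E) v x :=
    ((mdifferentiableAt_totalSpace 𝓘(ℝ, E) _).1 hV).2
  have h1 : mvfderiv 𝓘(ℝ, E') (fun y ↦ (e ⟨f y, J (f y) (V y)⟩).2) x w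
      = mvfderiv 𝓘(ℝ, E) (fun y ↦ A y (v x)) a (mfderiv 𝓘(ℝ, E') 𝓘(ℝ, E) f x w)
        + A a (mvfderiv 𝓘(ℝ, E') v x w) := by
    have hc : mvfderiv 𝓘(ℝ, E') (fun y ↦ (e ⟨f y, J (f y) (V y)⟩).2) x
        = mvfderiv 𝓘(ℝ, E') (fun y ↦ (A ∘ f) y (v y)) x := by
      apply mvfderiv_congr_of_eventuallyEq
      filter_upwards [hf.continuousAt.eventually hnhds] with y hy
      exact hcoord hy _
    rw [hc, mvfderiv_clm_apply (hA.comp x hf) hv]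
    congr 1
    exact mvfderiv_comp_of_normedSpace (G := fun y ↦ A y (v x))
      (hA.clm_apply mdifferentiableAt_const) hf w
  let σ : Π y : M, TangentSpace 𝓘(ℝ, E) y := FiberBundle.extend E (V x)
  have hσ : MDifferentiableAt 𝓘(ℝ, E) 𝓘(ℝ, E).tangent
      (fun y ↦ (⟨y, σ y⟩ : TangentBundle 𝓘(ℝ, E) M)) a :=
    FiberBundle.mdifferentiableAt_extend ..
  have hJσ : MDifferentiableAt 𝓘(ℝ, E) 𝓘(ℝ, E).tangent
      (fun y ↦ (⟨y, J y (σ y)⟩ : TangentBundle 𝓘(ℝ, E) M)) a := hJd.clm_bundle_apply hσ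
  have hσa : σ a = V x := FiberBundle.extend_apply_self ..
  have h3 : mvfderiv 𝓘(ℝ, E) (fun y ↦ (e ⟨y, J y (σ y)⟩).2) a
      = mvfderiv 𝓘(ℝ, E) (fun y ↦ A y (v x)) a := by
    apply mvfderiv_congr_of_eventuallyEq
    filter_upwards [hnhds] with y hy
    rw [hcoord hy]
    exact congrArg (A y) (trivializationAt_extend_snd _ hy)
  -- Parallelism on M is applied to the frame-constant extension σ of V x. It expresses the
  -- derivative of A on the frozen vector `v x`, the extra term in `h1`, through Christoffel terms.
  have h2 : J a (cov σ a (mfderiv 𝓘(ℝ, E') 𝓘(ℝ, E) f x w))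
      = e.symmL ℝ a (mvfderiv 𝓘(ℝ, E) (fun y ↦ A y (v x)) a (mfderiv 𝓘(ℝ, E') 𝓘(ℝ, E) f x w))
        + cov (FiberBundle.extend E (J a (V x))) a (mfderiv 𝓘(ℝ, E') 𝓘(ℝ, E) f x w) := by
    rw [← hJ σ a _ hσ, cov_eq_mvfderiv_add_cov_extend cov hJσ, ← h3, hσa]
  change e.symmL ℝ a (mvfderiv 𝓘(ℝ, E') (fun y ↦ (e ⟨f y, J (f y) (V y)⟩).2) x w)
      + cov (FiberBundle.extend E (J a (V x))) a (mfderiv 𝓘(ℝ, E') 𝓘(ℝ, E) f x w)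
    = J a (e.symmL ℝ a (mvfderiv 𝓘(ℝ, E') v x w) + cov σ a (mfderiv 𝓘(ℝ, E') 𝓘(ℝ, E) f x w))
  rw [h1, map_add, map_add, hsymm, h2]
  abel

/-- Vector fields that are constant in the trivialization at `a` commute at `a`. -/
theorem mlieBracket_extend_extend [FiniteDimensional ℝ E] {a : M} (u v : TangentSpace 𝓘(ℝ, E) a) :
    VectorField.mlieBracket 𝓘(ℝ, E) (FiberBundle.extend E u) (FiberBundle.extend E v) a = 0 := by
  have : CompleteSpace E := FiniteDimensional.complete ℝ E
  have hφ : ContMDiffAt 𝓘(ℝ, E) 𝓘(ℝ, E) ∞ (extChartAt 𝓘(ℝ, E) a) a := contMDiffAt_extChartAt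
  have h0 (z : TangentSpace 𝓘(ℝ, E) a) :
      mvfderiv 𝓘(ℝ, E) (fun y ↦ mvfderiv 𝓘(ℝ, E) (extChartAt 𝓘(ℝ, E) a) y
        (FiberBundle.extend E z y)) a = 0 := by
    rw [← mvfderiv_const (I := 𝓘(ℝ, E))
      ((trivializationAt E (TangentSpace 𝓘(ℝ, E) : M → Type _) a ⟨a, z⟩).2 : E) (x := a)]
    apply mvfderiv_congr_of_eventuallyEq
    filter_upwards [(chartAt E a).open_source.mem_nhds (mem_chart_source E a)] with y hy
    rw [← trivializationAt_snd_eq_mvfderiv hy]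
    exact trivializationAt_extend_snd _ hy
  -- The commutator identity is applied to the chart itself. Its derivative along a frame-constant
  -- field is constant, so both second derivatives vanish, and the differential of the chart is
  -- injective.
  have h := mvfderiv_mvfderiv_apply_sub hφ
    (U := FiberBundle.extend E v) (W := FiberBundle.extend E u)
    (FiberBundle.mdifferentiableAt_extend ..) (FiberBundle.mdifferentiableAt_extend ..)
  rw [h0, h0] at h
  have hinj : Function.Injective (mfderiv 𝓘(ℝ, E) 𝓘(ℝ, E) (extChartAt 𝓘(ℝ, E) a) a) :=
    (isInvertible_mfderiv_extChartAt (mem_extChartAt_source a)).bijective.injective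
  apply hinj
  rw [map_zero]
  refine Eq.trans h.symm ?_
  simp
  rfl

/-- The pull-back along a smooth map of a torsion-free connection is torsion-free. -/
theorem IsLeviCivita.covAlong_pushforward_sub [FiniteDimensional ℝ E] [FiniteDimensional ℝ E']
    [IsManifold 𝓘(ℝ, E') ∞ N]
    {g : SemiRiemannianMetric E M}
    {cov : CovariantDerivative 𝓘(ℝ, E) E (TangentSpace 𝓘(ℝ, E) : M → Type _)}
    (hcov : IsLeviCivita g cov) {f : N → M} {x : N} (hf : ContMDiff 𝓘(ℝ, E') 𝓘(ℝ, E) ∞ f)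
    {U W : Π y : N, TangentSpace 𝓘(ℝ, E') y}
    (hU : MDifferentiableAt 𝓘(ℝ, E') 𝓘(ℝ, E').tangent
      (fun y ↦ (⟨y, U y⟩ : TangentBundle 𝓘(ℝ, E') N)) x)
    (hW : MDifferentiableAt 𝓘(ℝ, E') 𝓘(ℝ, E').tangent
      (fun y ↦ (⟨y, W y⟩ : TangentBundle 𝓘(ℝ, E') N)) x) :
    covAlong cov f (pushforward f U) x (W x) - covAlong cov f (pushforward f W) x (U x)
      = pushforward f (VectorField.mlieBracket 𝓘(ℝ, E') W U) x := by
  have : CompleteSpace E' := FiniteDimensional.complete ℝ E'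
  let a := f x
  let e := trivializationAt E (TangentSpace 𝓘(ℝ, E) : M → Type _) a
  have hae : a ∈ e.baseSet := FiberBundle.mem_baseSet_trivializationAt' a
  have hnhds : ∀ᶠ y in 𝓝 x, f y ∈ (chartAt E a).source :=
    hf.continuous.continuousAt.eventually
      ((chartAt E a).open_source.mem_nhds (mem_chart_source E a))
  -- With G the chart composed with f, the coordinates of f_* Z are the derivative of G along Z, so
  -- the flat parts differ by the bracket term.
  let G : N → E := extChartAt 𝓘(ℝ, E) a ∘ f
  have hG : ContMDiffAt 𝓘(ℝ, E') 𝓘(ℝ, E) ∞ G x := contMDiffAt_extChartAt.comp x hf.contMDiffAt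
  have hdG {y : N} (hy : f y ∈ (chartAt E a).source) (z : TangentSpace 𝓘(ℝ, E') y) :
      (e ⟨f y, mfderiv 𝓘(ℝ, E') 𝓘(ℝ, E) f y z⟩).2 = mvfderiv 𝓘(ℝ, E') G y z := by
    rw [trivializationAt_snd_eq_mvfderiv hy]
    exact (mvfderiv_comp_of_normedSpace (mdifferentiableAt_extChartAt hy)
      (hf.mdifferentiableAt (by simp)) z).symm
  have hcoord (Z : Π y : N, TangentSpace 𝓘(ℝ, E') y) :
      mvfderiv 𝓘(ℝ, E') (fun y ↦ (e ⟨f y, pushforward f Z y⟩).2) x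
        = mvfderiv 𝓘(ℝ, E') (fun y ↦ mvfderiv 𝓘(ℝ, E') G y (Z y)) x := by
    apply mvfderiv_congr_of_eventuallyEq
    filter_upwards [hnhds] with y hy
    exact hdG hy _
  -- Frame-constant fields commute at a, so vanishing torsion says that the Christoffel term is
  -- symmetric.
  have htor := hcov.torsion_free (FiberBundle.extend E (pushforward f W x))
    (FiberBundle.extend E (pushforward f U x)) a
    (FiberBundle.mdifferentiableAt_extend ..) (FiberBundle.mdifferentiableAt_extend ..)
  rw [mlieBracket_extend_extend, FiberBundle.extend_apply_self,
    FiberBundle.extend_apply_self] at htor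
  have hbr := mvfderiv_mvfderiv_apply_sub hG hU hW
  rw [← hcoord, ← hcoord, ← hdG (mem_chart_source E a),
    trivializationAt_snd_eq_continuousLinearMapAt hae] at hbr
  have hbr' := congrArg (e.symmL ℝ a) hbr
  rw [e.symmL_continuousLinearMapAt hae, map_sub] at hbr'
  change e.symmL ℝ a (mvfderiv 𝓘(ℝ, E') (fun y ↦ (e ⟨f y, pushforward f U y⟩).2) x (W x))
      + cov (FiberBundle.extend E (pushforward f U x)) a (pushforward f W x)
      - (e.symmL ℝ a (mvfderiv 𝓘(ℝ, E') (fun y ↦ (e ⟨f y, pushforward f W y⟩).2) x (U x))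
      + cov (FiberBundle.extend E (pushforward f W x)) a (pushforward f U x)) = _
  rw [add_sub_add_comm, hbr', htor, add_zero]
  rfl
end

/-! ### Orthogonality in TN ⊕ ltr(TN) ⊕ S(TN^⊥) and the induced objects -/

section
variable {E : Type*} [NormedAddCommGroup E] [NormedSpace ℝ E]
  {M : Type*} [TopologicalSpace M] [ChartedSpace E M] [IsManifold 𝓘(ℝ, E) ∞ M]
  {E' : Type*} [NormedAddCommGroup E'] [NormedSpace ℝ E']
  {N : Type*} [TopologicalSpace N] [ChartedSpace E' N]
  {g : SemiRiemannianMetric E M} {f : N → M}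

namespace LightlikeSubmanifold

theorem inner_screenTrans_eq_zero (L : LightlikeSubmanifold E' g f) {x : N}
    {v w : TangentSpace 𝓘(ℝ, E) (f x)} (hv : v ∈ L.screenTrans x)
    (hw : w ∈ tangentAlong E' f x ⊔ L.ltr x) : g.inner (f x) w v = 0 := by
  obtain ⟨t, ht, l, hl, rfl⟩ := Submodule.mem_sup.1 hw
  have hvn : v ∈ normalAlong E' g f x := L.radical_sup_screenTrans x ▸ Submodule.mem_sup_right hv
  rw [map_add, add_apply, g.symm, hvn t ht, L.ltr_orth_screenTrans x l hl v hv, add_zero]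

theorem inner_ltr_eq_zero (L : LightlikeSubmanifold E' g f) {x : N}
    {ξ w : TangentSpace 𝓘(ℝ, E) (f x)} (hξ : ξ ∈ L.ltr x)
    (hw : w ∈ L.ltr x ⊔ L.screenTrans x) : g.inner (f x) w ξ = 0 := by
  obtain ⟨l, hl, s, hs, rfl⟩ := Submodule.mem_sup.1 hw
  rw [map_add, add_apply, L.ltr_null x l hl ξ hξ, g.symm, L.ltr_orth_screenTrans x ξ hξ s hs,
    add_zero]

/-- The pairing of `Rad(TN)` with `ltr(TN)` is nondegenerate. -/
theorem eq_zero_of_mem_radical (L : LightlikeSubmanifold E' g f) {x : N}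
    {v : TangentSpace 𝓘(ℝ, E) (f x)} (hv : v ∈ radicalAlong E' g f x)
    (h : ∀ ξ ∈ L.ltr x, g.inner (f x) v ξ = 0) : v = 0 := by
  refine g.nondegenerate _ v fun w ↦ ?_
  -- A radical vector is orthogonal to TN and, being tangent, to S(TN^⊥); only the ltr(TN) component
  -- of w can contribute.
  have hw : w ∈ L.screenTrans x ⊔ (tangentAlong E' f x ⊔ L.ltr x) :=
    (L.isCompl_screenTrans x).sup_eq_top ▸ Submodule.mem_top
  obtain ⟨s, hs, w', hw', rfl⟩ := Submodule.mem_sup.1 hw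
  obtain ⟨t, ht, l, hl, rfl⟩ := Submodule.mem_sup.1 hw'
  rw [map_add, map_add, L.inner_screenTrans_eq_zero hs (Submodule.mem_sup_left hv.1),
    hv.2 t ht, h l hl, add_zero, add_zero]

/-- The screen distribution is the orthogonal complement of `ltr(TN)` in `TN`. -/
theorem mem_screen_iff (L : LightlikeSubmanifold E' g f) {x : N}
    {t : TangentSpace 𝓘(ℝ, E) (f x)} (ht : t ∈ tangentAlong E' f x) :
    t ∈ L.screen x ↔ ∀ ξ ∈ L.ltr x, g.inner (f x) t ξ = 0 := by
  refine ⟨fun h ξ hξ ↦ by rw [g.symm, L.ltr_orth_screen x ξ hξ t h], fun h ↦ ?_⟩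
  rw [← L.radical_sup_screen x] at ht
  obtain ⟨r, hr, s, hs, rfl⟩ := Submodule.mem_sup.1 ht
  -- As S(TN) is orthogonal to ltr(TN), the radical part r pairs with ltr(TN) exactly as t does.
  have hr0 : r = 0 := L.eq_zero_of_mem_radical hr fun ξ hξ ↦ by
    have := h ξ hξ
    rwa [map_add, add_apply, g.symm _ s, L.ltr_orth_screen x ξ hξ s hs, add_zero] at this
  rwa [hr0, zero_add]

theorem inducedConn_mem_tangentAlong (L : LightlikeSubmanifold E' g f)
    (cov : CovariantDerivative 𝓘(ℝ, E) E (TangentSpace 𝓘(ℝ, E) : M → Type _))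
    (W : Π x : N, TangentSpace 𝓘(ℝ, E') x) (V : Π x : N, TangentSpace 𝓘(ℝ, E) (f x)) (x : N) :
    L.inducedConn cov W V x ∈ tangentAlong E' f x :=
  Submodule.projection_apply_mem _ _

/-- The part removed by the projection lies in ltr(TN) ⊕ S(TN^⊥), which is orthogonal to ltr(TN). -/
theorem inner_inducedConn_ltr (L : LightlikeSubmanifold E' g f)
    (cov : CovariantDerivative 𝓘(ℝ, E) E (TangentSpace 𝓘(ℝ, E) : M → Type _))
    (W : Π x : N, TangentSpace 𝓘(ℝ, E') x) (V : Π x : N, TangentSpace 𝓘(ℝ, E) (f x)) {x : N}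
    {ξ : TangentSpace 𝓘(ℝ, E) (f x)} (hξ : ξ ∈ L.ltr x) :
    g.inner (f x) (L.inducedConn cov W V x) ξ = g.inner (f x) (covAlong cov f V x (W x)) ξ := by
  have h := L.inner_ltr_eq_zero hξ
    (Submodule.sub_projection_mem (L.isCompl_tangent x) (covAlong cov f V x (W x)))
  rw [map_sub, sub_apply, sub_eq_zero] at h
  exact h.symm

/-- The part removed by the projection lies in TN ⊕ ltr(TN), which is orthogonal to S(TN^⊥). -/
theorem inner_hs_screenTrans (L : LightlikeSubmanifold E' g f)
    (cov : CovariantDerivative 𝓘(ℝ, E) E (TangentSpace 𝓘(ℝ, E) : M → Type _))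
    (W : Π x : N, TangentSpace 𝓘(ℝ, E') x) (V : Π x : N, TangentSpace 𝓘(ℝ, E) (f x)) {x : N}
    {v : TangentSpace 𝓘(ℝ, E) (f x)} (hv : v ∈ L.screenTrans x) :
    g.inner (f x) (L.hs cov W V x) v = g.inner (f x) (covAlong cov f V x (W x)) v := by
  have h := L.inner_screenTrans_eq_zero hv
    (Submodule.sub_projection_mem (L.isCompl_screenTrans x) (covAlong cov f V x (W x)))
  rw [map_sub, sub_apply, sub_eq_zero] at h
  exact h.symm

/-- Projecting the torsion identity of the pull-back connection to TN leaves the bracket unchanged,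
since it is already tangent. -/
theorem pushforward_mlieBracket_eq [FiniteDimensional ℝ E] [FiniteDimensional ℝ E']
    [IsManifold 𝓘(ℝ, E') ∞ N] (L : LightlikeSubmanifold E' g f)
    {cov : CovariantDerivative 𝓘(ℝ, E) E (TangentSpace 𝓘(ℝ, E) : M → Type _)}
    (hcov : IsLeviCivita g cov) {U W : Π y : N, TangentSpace 𝓘(ℝ, E') y} {x : N}
    (hU : MDifferentiableAt 𝓘(ℝ, E') 𝓘(ℝ, E').tangent
      (fun y ↦ (⟨y, U y⟩ : TangentBundle 𝓘(ℝ, E') N)) x)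
    (hW : MDifferentiableAt 𝓘(ℝ, E') 𝓘(ℝ, E').tangent
      (fun y ↦ (⟨y, W y⟩ : TangentBundle 𝓘(ℝ, E') N)) x) :
    pushforward f (VectorField.mlieBracket 𝓘(ℝ, E') W U) x
      = L.inducedConn cov W (pushforward f U) x - L.inducedConn cov U (pushforward f W) x := by
  have hmem : pushforward (E := E) f (VectorField.mlieBracket 𝓘(ℝ, E') W U) x ∈
      tangentAlong (E := E) E' f x :=
    ⟨VectorField.mlieBracket 𝓘(ℝ, E') W U x, rfl⟩
  rw [inducedConn, inducedConn, ← map_sub,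
    hcov.covAlong_pushforward_sub L.isImmersion.contMDiff hU hW]
  exact (Submodule.projection_apply_of_mem_left (L.isCompl_tangent x) hmem).symm

end LightlikeSubmanifold

theorem mdifferentiable_pushforward [IsManifold 𝓘(ℝ, E') ∞ N]
    (hf : ContMDiff 𝓘(ℝ, E') 𝓘(ℝ, E) ∞ f) {U : Π y : N, TangentSpace 𝓘(ℝ, E') y}
    (hU : ContMDiff 𝓘(ℝ, E') 𝓘(ℝ, E').tangent ∞
      (fun y ↦ (⟨y, U y⟩ : TangentBundle 𝓘(ℝ, E') N))) :
    MDifferentiable 𝓘(ℝ, E') 𝓘(ℝ, E).tangent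
      (fun y ↦ (⟨f y, pushforward f U y⟩ : TangentBundle 𝓘(ℝ, E) M)) :=
  ((hf.contMDiff_tangentMap (m := ∞) (by simp)).comp hU).mdifferentiable (by simp)

end

end

/-! ### The criterion for a totally geodesic screen foliation -/

theorem mainTheorem11
    {E : Type*} [NormedAddCommGroup E] [NormedSpace ℝ E] [FiniteDimensional ℝ E]
    {M : Type*} [TopologicalSpace M] [T2Space M] [SecondCountableTopology M]
    [ChartedSpace E M] [IsManifold 𝓘(ℝ, E) ∞ M]
    {E' : Type*} [NormedAddCommGroup E'] [NormedSpace ℝ E'] [FiniteDimensional ℝ E']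
    {N : Type*} [TopologicalSpace N] [T2Space N] [SecondCountableTopology N]
    [ChartedSpace E' N] [IsManifold 𝓘(ℝ, E') ∞ N]
    (g : SemiRiemannianMetric E M)
    (cov : CovariantDerivative 𝓘(ℝ, E) E (TangentSpace 𝓘(ℝ, E) : M → Type _))
    (hcov : IsLeviCivita g cov)
    (J : Π x : M, TangentSpace 𝓘(ℝ, E) x →L[ℝ] TangentSpace 𝓘(ℝ, E) x) (p q : ℕ)
    (hJ : IsMetallic g J p q) (hparallel : IsParallel cov J)
    (f : N → M) (L : LightlikeSubmanifold E' g f)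
    (hrad : L.IsRadicalScreenTransversal J)
    (hltr : ∀ x, L.mapLtr J x ≤ L.screenTrans x) :
    L.DefinesTotallyGeodesicFoliation cov L.screen ↔
      ∀ W U : Π x : N, TangentSpace 𝓘(ℝ, E') x,
        IsSectionOf f L.screen W → IsSectionOf f L.screen U →
        ∀ x, g.HasNoComponentIn
          (L.hs cov W (fun y ↦ J (f y) (pushforward f U y)) x
            - (p : ℝ) • L.hs cov W (pushforward f U) x)
          (L.mapLtr J x) := by
  have hf := L.isImmersion.contMDiff
  have key (W U : Π x : N, TangentSpace 𝓘(ℝ, E') x) (hU : IsSectionOf f L.screen U) (x : N) :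
      g.HasNoComponentIn
          (L.hs cov W (fun y ↦ J (f y) (pushforward f U y)) x
            - (p : ℝ) • L.hs cov W (pushforward f U) x) (L.mapLtr J x) ↔
        L.inducedConn cov W (pushforward f U) x ∈ L.screen x := by
    rw [L.mem_screen_iff (L.inducedConn_mem_tangentAlong cov W _ x)]
    have hcovJ := hparallel.covAlong_apply (hJ.contMDiff.mdifferentiableAt (by simp))
      (hf.mdifferentiableAt (by simp)) (mdifferentiable_pushforward hf hU.1 x) (W x)
    -- Moving J onto Jξ gives J²ξ - pJξ = qξ; subtracting p h^s(W, U) is what removes the linear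
    -- term of the metallic equation.
    have hcomp (ξ : TangentSpace 𝓘(ℝ, E) (f x)) (hξ : ξ ∈ L.ltr x) :
        g.inner (f x) (L.hs cov W (fun y ↦ J (f y) (pushforward f U y)) x
            - (p : ℝ) • L.hs cov W (pushforward f U) x) (J (f x) ξ)
          = q * g.inner (f x) (L.inducedConn cov W (pushforward f U) x) ξ := by
      have hJξ : J (f x) ξ ∈ L.screenTrans x := hltr x (Submodule.mem_map_of_mem hξ)
      rw [map_sub, map_smul, sub_apply, smul_apply, L.inner_hs_screenTrans cov W _ hJξ,
        L.inner_hs_screenTrans cov W _ hJξ, L.inner_inducedConn_ltr cov W _ hξ, hcovJ,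
        hJ.compatible, hJ.sq, map_add, map_smul, map_smul]
      simp
    have hq : (q : ℝ) ≠ 0 := Nat.cast_ne_zero.2 hJ.q_pos.ne'
    constructor
    · intro h ξ hξ
      have := h _ (Submodule.mem_map_of_mem hξ)
      exact (mul_eq_zero.1 ((hcomp ξ hξ).symm.trans this)).resolve_left hq
    · rintro h _ ⟨ξ, hξ, rfl⟩
      exact (hcomp ξ hξ).trans (by rw [h ξ hξ, mul_zero])
  constructor
  · intro h W U hW hU x
    exact (key W U hU x).2 (h W U hW hU x).2
  · intro h W U hW hU x
    have hWU := (key W U hU x).1 (h W U hW hU x)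
    refine ⟨?_, hWU⟩
    rw [L.pushforward_mlieBracket_eq hcov (hU.1.mdifferentiableAt (by simp))
      (hW.1.mdifferentiableAt (by simp))]
    -- The bracket is ∇_W U - ∇_U W, so the criterion is also used with W and U exchanged.
    exact Submodule.sub_mem _ hWU ((key U W hW x).1 (h U W hU hW x))
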